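/- Let $\Lambda_1,\dots,\Lambda_n$ be measurable spaces, $\Lambda=\Lambda_1\times\dots\times\Lambda_n$, and let $X=(X_1,\dots,X_n)$ be a $\Lambda$-valued random vector. For positive integers $k,l$, we say that $X$ satisfies (HD,$l$,$k$) if there are finitely many independent random variables $Y_1,\dots,Y_N$ (with values in arbitrary measurable spaces) and sets $T_1,\dots,T_n\subseteq\{1,\dots,N\}$ such that each $X_i$ is a measurable function of $(Y_j)_{j\in T_i}$, $|T_i|\le l$ for every $i\le n$, and $|\{i\le n: j\in T_i\}|\le k$ for every $j\le N$. For $x\in\Lambda$ and nonempty $S\subseteq\Lambda$, Talagrand's convex distance is $$d_T(x,S)=\sup_{\alpha\in[0,\infty)^n,\ \|\alpha\|_2=1}\ \inf_{y\in S}\ \sum_{i=1}^n\alpha_i\mathbf 1[x_i\ne y_i],$$ and, for $t\ge 0$, $S_t=\{x\in\Lambda: d_T(x,S)\le t\}$. Suppose that $X$ satisfies (HD,$l$,$k$), and let $S\subseteq\Lambda$ be a measurable set such that $d_T(\cdot,S)$ is measurable with respect to the completion of the law of $X$. If $\mathbb P(X\in S)>0$, then $$\mathbb E\exp\left(\frac{d_T^2(X,S)}{10kl}\right)\le\frac1{\mathbb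 P(X\in S)},$$ and, for every $t\ge 0$, $$\mathbb P(X\in S)\,\mathbb P(X\notin S_t)\le\exp\left(-\frac{t^2}{10kl}\right).$$ (The second inequality holds trivially when $\mathbb P(X\in S)=0$.) -/

import Mathlib

open MeasureTheory ProbabilityTheory

universe u v w

/-- (HD, `k`, `l`) dependence (hypergraph dependence) of a random vector `X = (X₁, …, Xₙ)`
under `μ`: there are finitely many independent random variables `Y₁, …, Y_N` and subsets
`T₁, …, Tₙ` of `[N]` such that `Xᵢ` is a (measurable) function of the `Yⱼ` with `j ∈ Tᵢ`, every
`Tᵢ` has at most `k` elements, and every `j` belongs to at most `l` of the sets `Tᵢ`. -/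
def HDDependent {Ω : Type v} [MeasurableSpace Ω] {n : ℕ} {Λ : Fin n → Type u}
    [∀ i, MeasurableSpace (Λ i)] (X : Ω → (i : Fin n) → Λ i) (μ : Measure Ω) (k l : ℕ) : Prop :=
  ∃ (N : ℕ) (E : Fin N → Type w) (_ : ∀ j, MeasurableSpace (E j))
    (Y : (j : Fin N) → Ω → E j) (T : Fin n → Finset (Fin N)),
    (∀ j, Measurable (Y j)) ∧
    iIndepFun Y μ ∧
    (∀ i, ∃ f : ((j : T i) → E j) → Λ i,
      Measurable f ∧ ∀ ω, X ω i = f (fun j => Y j ω)) ∧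
    (∀ i, (T i).card ≤ k) ∧
    (∀ j, (Finset.univ.filter (fun i => j ∈ T i)).card ≤ l)

open Classical in
/-- Talagrand's convex distance of `x` from a nonempty set `S`:
`sup_{α ≥ 0, |α|₂ = 1} inf_{y ∈ S} ∑ i, α i * 1[x i ≠ y i]`. -/
noncomputable def convexDist {n : ℕ} {Λ : Fin n → Type u}
    (x : (i : Fin n) → Λ i) (S : Set ((i : Fin n) → Λ i)) : ℝ :=
  ⨆ α : {α : Fin n → ℝ // (∀ i, 0 ≤ α i) ∧ ∑ i, α i ^ 2 = 1},
    ⨅ y : S, ∑ i, if x i ≠ y.1 i then α.1 i else 0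

/-- The enlargement `S_t` of `S`: the points at convex distance at most `t` from `S`. -/
def convexEnlargement {n : ℕ} {Λ : Fin n → Type u}
    (S : Set ((i : Fin n) → Λ i)) (t : ℝ) : Set ((i : Fin n) → Λ i) :=
  {x | convexDist x S ≤ t}

/-! Write X = F(Y) with independent Y_j. Weights α on the coordinates of X push forward to β_j =
∑_{i : j ∈ T_i} α_i. A change in X_i forces a change in some Y_j with j ∈ T_i, and ‖β‖² ≤ kl‖α‖², so
passing from Y to X costs a factor kl in the squared distance (`convexDist_sq_le_of_dependsOn`).
Talagrand's bound E exp(d²/4) ≤ 1/P for product measures then gives 4kl, better than 10kl, and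
Markov's inequality gives the tail.

The distance to F⁻¹(S) need not be measurable, so `exists_measurable_convexDistSqLE` builds a
measurable majorant by induction on the dimension. With f and g majorants for the section at x_0
(measure p) and for the essential projection (measure q), the new majorant is (1-w)² + wf + (1-w)g
(`ConvexDistSqLE.convexComb`). Hölder and a good choice of w = w(p/q) bound the inner integral by (2
- p/q)/q; integrating over x_0 closes the induction (`lintegral_exp_stepEnvelope_le`). -/

/-! ### The optimal interpolation weight -/

theorem Real.exp_sub_sq_add_exp_neg_le_two {u : ℝ} (h0 : 0 ≤ u) (h1 : u ≤ 1 / 2) :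
    Real.exp (u - u ^ 2) + Real.exp (-u) ≤ 2 := by
  have hv0 : 0 ≤ u - u ^ 2 := by nlinarith
  have hv1 : u - u ^ 2 ≤ 1 := by nlinarith
  have h2 := Real.exp_bound' hv0 hv1 (n := 3) (by norm_num)
  norm_num [Finset.sum_range_succ, Nat.factorial] at h2
  have h3 : Real.exp (-u) ≤ 1 - u + u ^ 2 / 2 := by
    have h4 := Real.quadratic_le_exp_of_nonneg h0
    have h5 : Real.exp (-u) * Real.exp u = 1 := by rw [← Real.exp_add]; simp
    nlinarith [Real.exp_pos (-u), Real.exp_pos u, sq_nonneg (u ^ 2), sq_nonneg (u - 1)]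
  have h6 : (u - u ^ 2) ^ 3 ≤ u ^ 3 := by
    apply pow_le_pow_left₀ hv0; nlinarith
  have h7 : 0 ≤ u ^ 3 := by positivity
  -- The linear and quadratic terms cancel, leaving at most 2 - u³(1 - 2/9 - u/2).
  nlinarith [mul_nonneg h7 (sub_nonneg.2 h1)]

/-- The interpolation weight in Talagrand's induction, as a function of the ratio of the measure of
a section to that of the projection. -/
noncomputable def talagrandWeight (r : ℝ) : ℝ :=
  if Real.exp (-(1 / 2)) ≤ r then min 1 (1 + 2 * Real.log r) else 0

theorem measurable_talagrandWeight : Measurable talagrandWeight := by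
  unfold talagrandWeight
  refine Measurable.ite measurableSet_Ici ?_ measurable_const
  fun_prop

theorem talagrandWeight_nonneg (r : ℝ) : 0 ≤ talagrandWeight r := by
  unfold talagrandWeight
  split_ifs with h
  · have := (Real.le_log_iff_exp_le ((Real.exp_pos _).trans_le h)).2 h
    exact le_min zero_le_one (by linarith)
  · exact le_rfl

theorem talagrandWeight_le_one (r : ℝ) : talagrandWeight r ≤ 1 := by
  unfold talagrandWeight
  split_ifs with h
  · exact min_le_left _ _
  · exact zero_le_one

theorem pos_of_talagrandWeight_ne_zero {r : ℝ} (h : talagrandWeight r ≠ 0) : 0 < r := by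
  unfold talagrandWeight at h
  split_ifs at h with h'
  · exact (Real.exp_pos _).trans_le h'
  · exact absurd rfl h

/-- The weight 1 + 2 log r is the critical point of the exponent; there, with u = -log r, the
exponent equals u - u². Below e^{-1/2} that point is negative, so the weight is 0, and the endpoint
u = 1/2 suffices. -/
theorem exp_talagrandWeight_le {r : ℝ} (h0 : 0 ≤ r) (h1 : r ≤ 1) :
    Real.exp ((1 - talagrandWeight r) ^ 2 / 4 - talagrandWeight r * Real.log r) ≤ 2 - r := by
  unfold talagrandWeight
  split_ifs with h
  · have hr : 0 < r := (Real.exp_pos _).trans_le h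
    have h2 := (Real.le_log_iff_exp_le hr).2 h
    have h3 := Real.log_nonpos h0 h1
    rw [min_eq_right (by linarith)]
    have h4 := Real.exp_sub_sq_add_exp_neg_le_two (u := -Real.log r) (by linarith) (by linarith)
    rw [neg_neg, Real.exp_log hr] at h4
    calc _ = Real.exp (-Real.log r - (-Real.log r) ^ 2) := by congr 1; ring
      _ ≤ _ := by linarith
  · have h4 := Real.exp_sub_sq_add_exp_neg_le_two (u := 1 / 2) (by norm_num) le_rfl
    push Not at h
    norm_num at h4 h ⊢
    linarith

open ENNReal in
theorem exp_mul_rpow_talagrandWeight_le {p q : ℝ≥0∞} (hq : q ≠ 0) (hq' : q ≠ ⊤) (hpq : p ≤ q) :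
    ENNReal.ofReal (Real.exp ((1 - talagrandWeight (p.toReal / q.toReal)) ^ 2 / 4)) *
      ((p⁻¹) ^ talagrandWeight (p.toReal / q.toReal) *
        (q⁻¹) ^ (1 - talagrandWeight (p.toReal / q.toReal))) ≤
      ENNReal.ofReal (2 - p.toReal / q.toReal) * q⁻¹ := by
  have hQ : 0 < q.toReal := ENNReal.toReal_pos hq hq'
  have hr1 : p.toReal / q.toReal ≤ 1 :=
    div_le_one_of_le₀ (ENNReal.toReal_mono hq' hpq) hQ.le
  have hr0 : 0 ≤ p.toReal / q.toReal := by positivity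
  have key := exp_talagrandWeight_le hr0 hr1
  -- Here p may vanish, but then p⁻¹ = ⊤ is raised to the power 0.
  by_cases hw : talagrandWeight (p.toReal / q.toReal) = 0
  · rw [hw] at key ⊢
    simp only [rpow_zero, one_mul, sub_zero, rpow_one]
    gcongr
    simpa using key
  · have hr := pos_of_talagrandWeight_ne_zero hw
    have hP : 0 < p.toReal := by
      by_contra! h
      have := le_antisymm h ENNReal.toReal_nonneg
      simp [this] at hr
    have hp' : p ≠ ⊤ := (hpq.trans_lt hq'.lt_top).ne
    set w := talagrandWeight (p.toReal / q.toReal)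
    set P := p.toReal with hPdef
    set Q := q.toReal with hQdef
    have e1 : p⁻¹ = ENNReal.ofReal (P⁻¹) := by
      rw [ENNReal.ofReal_inv_of_pos hP, ENNReal.ofReal_toReal hp']
    have e2 : q⁻¹ = ENNReal.ofReal (Q⁻¹) := by
      rw [ENNReal.ofReal_inv_of_pos hQ, ENNReal.ofReal_toReal hq']
    rw [e1, e2, ENNReal.ofReal_rpow_of_pos (inv_pos.2 hP), ENNReal.ofReal_rpow_of_pos (inv_pos.2 hQ),
      ← ENNReal.ofReal_mul (by positivity), ← ENNReal.ofReal_mul (by positivity),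
      ← ENNReal.ofReal_mul (by linarith)]
    apply ENNReal.ofReal_le_ofReal
    have e3 : Real.exp ((1 - w) ^ 2 / 4) * (P⁻¹ ^ w * Q⁻¹ ^ (1 - w)) =
        Real.exp ((1 - w) ^ 2 / 4 - w * Real.log (P / Q)) * Q⁻¹ := by
      rw [Real.rpow_def_of_pos (inv_pos.2 hP), Real.rpow_def_of_pos (inv_pos.2 hQ),
        Real.log_div hP.ne' hQ.ne', Real.log_inv, Real.log_inv]
      conv_rhs => rw [← Real.exp_log (inv_pos.2 hQ), Real.log_inv]
      rw [← Real.exp_add, ← Real.exp_add, ← Real.exp_add]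
      congr 1; ring
    rw [e3]
    gcongr

/-! ### Integrating out one coordinate -/

open ENNReal in
theorem lintegral_exp_convexComb_le {B : Type*} [MeasurableSpace B] {ρ : Measure B}
    {f g : B → ℝ} (hf : Measurable f) (hg : Measurable g) {c t : ℝ} (h0 : 0 ≤ t) (h1 : t ≤ 1) :
    ∫⁻ b, ENNReal.ofReal (Real.exp ((c + (t * f b + (1 - t) * g b)) / 4)) ∂ρ ≤
      ENNReal.ofReal (Real.exp (c / 4)) *
        ((∫⁻ b, ENNReal.ofReal (Real.exp (f b / 4)) ∂ρ) ^ t *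
          (∫⁻ b, ENNReal.ofReal (Real.exp (g b / 4)) ∂ρ) ^ (1 - t)) := by
  have hf' : Measurable fun b => ENNReal.ofReal (Real.exp (f b / 4)) := by fun_prop
  have hg' : Measurable fun b => ENNReal.ofReal (Real.exp (g b / 4)) := by fun_prop
  calc _ = ∫⁻ b, ENNReal.ofReal (Real.exp (c / 4)) * (ENNReal.ofReal (Real.exp (f b / 4)) ^ t *
          ENNReal.ofReal (Real.exp (g b / 4)) ^ (1 - t)) ∂ρ := by
        refine lintegral_congr fun b => ?_
        rw [ENNReal.ofReal_rpow_of_pos (Real.exp_pos _), ENNReal.ofReal_rpow_of_pos (Real.exp_pos _),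
          ← ENNReal.ofReal_mul (by positivity), ← ENNReal.ofReal_mul (by positivity),
          ← Real.exp_mul, ← Real.exp_mul, ← Real.exp_add, ← Real.exp_add]
        congr 2; ring
    _ = ENNReal.ofReal (Real.exp (c / 4)) * ∫⁻ b, (ENNReal.ofReal (Real.exp (f b / 4)) ^ t *
          ENNReal.ofReal (Real.exp (g b / 4)) ^ (1 - t)) ∂ρ := by
        rw [lintegral_const_mul' _ _ ENNReal.ofReal_ne_top]
    _ ≤ _ := by
        gcongr
        exact ENNReal.lintegral_mul_norm_pow_le hf'.aemeasurable hg'.aemeasurable h0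
          (by linarith) (by ring)

/-- The points `b` over which `S` has a section of positive measure. -/
def essProj {A B : Type*} [MeasurableSpace A] (ν : Measure A) (S : Set (A × B)) : Set B :=
  {b | ν {a | (a, b) ∈ S} ≠ 0}

/-- The envelope of `S` built from envelopes `f` of its sections and `g` of its projection. -/
noncomputable def stepEnvelope {A B : Type*} [MeasurableSpace A] [MeasurableSpace B]
    (ν : Measure A) (ρ : Measure B) (S : Set (A × B)) (f : A × B → ℝ) (g : B → ℝ)
    (z : A × B) : ℝ :=
  (1 - talagrandWeight ((ρ {b | (z.1, b) ∈ S}).toReal / (ρ (essProj ν S)).toReal)) ^ 2 +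
    (talagrandWeight ((ρ {b | (z.1, b) ∈ S}).toReal / (ρ (essProj ν S)).toReal) * f z +
      (1 - talagrandWeight ((ρ {b | (z.1, b) ∈ S}).toReal / (ρ (essProj ν S)).toReal)) * g z.2)

section step
variable {A B : Type*} [MeasurableSpace A] [MeasurableSpace B]
    {ν : Measure A} {ρ : Measure B} [IsProbabilityMeasure ν] [IsProbabilityMeasure ρ]
    {S : Set (A × B)}

theorem measurableSet_essProj (hS : MeasurableSet S) : MeasurableSet (essProj ν S) :=
  (measurable_measure_prodMk_right hS) (measurableSet_singleton 0).compl

/-- By Fubini, the part of S lying over the complement of `essProj` is null. The essential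
projection replaces the true one, which need not be measurable. -/
theorem ae_measure_section_le_essProj (hS : MeasurableSet S) :
    ∀ᵐ a ∂ν, ρ {b | (a, b) ∈ S} ≤ ρ (essProj ν S) := by
  have hm : MeasurableSet {z : A × B | z ∈ S → z.2 ∈ essProj ν S} := by
    have : {z : A × B | z ∈ S → z.2 ∈ essProj ν S} = Sᶜ ∪ Prod.snd ⁻¹' (essProj ν S) := by
      ext z; simp [imp_iff_not_or]
    rw [this]
    exact hS.compl.union (measurable_snd (measurableSet_essProj hS))
  have h : ∀ᵐ z ∂(ν.prod ρ), z ∈ S → z.2 ∈ essProj ν S := by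
    change ∀ᵐ z ∂(ν.prod ρ), z ∈ {z : A × B | z ∈ S → z.2 ∈ essProj ν S}
    rw [← Measure.prod_swap]
    refine (ae_map_iff measurable_swap.aemeasurable hm).2 ?_
    refine (Measure.ae_prod_mem_iff_ae_ae_mem (measurable_swap hm)).2 (ae_of_all _ fun b => ?_)
    by_cases hb : b ∈ essProj ν S
    · simp [hb]
    · have : ν {a | (a, b) ∈ S} = 0 := by simpa [essProj] using hb
      have h2 : ∀ᵐ a ∂ν, (a, b) ∉ S := by rw [ae_iff]; simpa using this
      filter_upwards [h2] with a ha
      simp [ha]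
  filter_upwards [Measure.ae_ae_of_ae_prod h] with a ha
  exact measure_mono_ae ha

theorem measure_essProj_ne_zero (hS : MeasurableSet S) (h : (ν.prod ρ) S ≠ 0) :
    ρ (essProj ν S) ≠ 0 := by
  intro h0
  apply h
  rw [Measure.measure_prod_null hS]
  filter_upwards [ae_measure_section_le_essProj (ν := ν) (ρ := ρ) hS] with a ha
  rw [h0] at ha
  exact le_antisymm ha (zero_le)

theorem lintegral_exp_stepEnvelope_le (hS : MeasurableSet S)
    {f : A × B → ℝ} {g : B → ℝ} (hf : Measurable f) (hg : Measurable g)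
    (hfi : ∀ a, ∫⁻ b, ENNReal.ofReal (Real.exp (f (a, b) / 4)) ∂ρ ≤ (ρ {b | (a, b) ∈ S})⁻¹)
    (hgi : ∫⁻ b, ENNReal.ofReal (Real.exp (g b / 4)) ∂ρ ≤ (ρ (essProj ν S))⁻¹) :
    ∫⁻ z, ENNReal.ofReal (Real.exp (stepEnvelope ν ρ S f g z / 4)) ∂(ν.prod ρ) ≤
      ((ν.prod ρ) S)⁻¹ := by
  by_cases h : (ν.prod ρ) S = 0
  · simp [h]
  have hq := measure_essProj_ne_zero hS h
  have hq' : ρ (essProj ν S) ≠ ⊤ := measure_ne_top _ _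
  have hQ : 0 < (ρ (essProj ν S)).toReal := ENNReal.toReal_pos hq hq'
  have hp : Measurable fun a => ρ {b | (a, b) ∈ S} := measurable_measure_prodMk_left hS
  have hint : Integrable (fun a => (ρ {b | (a, b) ∈ S}).toReal) ν := by
    refine Integrable.of_bound (C := 1) hp.ennreal_toReal.aestronglyMeasurable (ae_of_all _ fun a => ?_)
    rw [Real.norm_of_nonneg ENNReal.toReal_nonneg]
    exact measureReal_le_one
  have hI : ∫ a, (ρ {b | (a, b) ∈ S}).toReal ∂ν = ((ν.prod ρ) S).toReal := by
    rw [Measure.prod_apply hS, integral_toReal hp.aemeasurable (ae_of_all _ fun a => measure_lt_top _ _)]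
    rfl
  have hP : 0 < ((ν.prod ρ) S).toReal := ENNReal.toReal_pos h (measure_ne_top _ _)
  have hle := ae_measure_section_le_essProj (ν := ν) (ρ := ρ) hS
  -- Only this direction of Tonelli is needed, and it requires no measurability.
  calc _ ≤ ∫⁻ a, ∫⁻ b, ENNReal.ofReal (Real.exp (stepEnvelope ν ρ S f g (a, b) / 4)) ∂ρ ∂ν :=
        lintegral_prod_le _
    _ ≤ ∫⁻ a, ENNReal.ofReal (2 - (ρ {b | (a, b) ∈ S}).toReal / (ρ (essProj ν S)).toReal) *
          (ρ (essProj ν S))⁻¹ ∂ν := by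
        refine lintegral_mono_ae ?_
        filter_upwards [hle] with a ha
        refine le_trans ?_ (exp_mul_rpow_talagrandWeight_le hq hq' ha)
        let w := talagrandWeight ((ρ {b | (a, b) ∈ S}).toReal / (ρ (essProj ν S)).toReal)
        have hH := lintegral_exp_convexComb_le (ρ := ρ) (f := fun b => f (a, b)) (g := g)
          (c := (1 - w) ^ 2) (t := w) (hf.comp measurable_prodMk_left) hg
          (talagrandWeight_nonneg _) (talagrandWeight_le_one _)
        refine le_trans hH ?_
        gcongr
        · exact talagrandWeight_nonneg _
        · exact hfi a
        · exact sub_nonneg.2 (talagrandWeight_le_one _)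
    _ = ENNReal.ofReal (2 - ((ν.prod ρ) S).toReal / (ρ (essProj ν S)).toReal) *
          (ρ (essProj ν S))⁻¹ := by
        rw [lintegral_mul_const' _ _ (ENNReal.inv_ne_top.2 hq), ← ofReal_integral_eq_lintegral_ofReal]
        · rw [integral_sub (integrable_const _) (hint.div_const _), integral_div, hI]
          simp
        · exact (integrable_const _).sub (hint.div_const _)
        · filter_upwards [hle] with a ha
          have := div_le_one_of_le₀ (ENNReal.toReal_mono hq' ha) hQ.le
          simp only [Pi.zero_apply]
          linarith
    _ ≤ ((ν.prod ρ) S)⁻¹ := by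
        rw [← ENNReal.ofReal_toReal hq', ← ENNReal.ofReal_toReal (measure_ne_top (ν.prod ρ) S),
          ← ENNReal.ofReal_inv_of_pos hQ, ← ENNReal.ofReal_inv_of_pos hP,
          ← ENNReal.ofReal_mul' (inv_nonneg.2 hQ.le), ENNReal.toReal_ofReal hQ.le,
          ENNReal.toReal_ofReal hP.le]
        apply ENNReal.ofReal_le_ofReal
        -- With u = P/Q the claim is u(2 - u) = 1 - (1 - u)² ≤ 1.
        rw [← div_eq_mul_inv, div_le_iff₀ hQ, inv_mul_eq_div, le_div_iff₀ hP]
        have e : (2 - ((ν.prod ρ) S).toReal / (ρ (essProj ν S)).toReal) * ((ν.prod ρ) S).toReal =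
          (ρ (essProj ν S)).toReal * (1 - (1 - ((ν.prod ρ) S).toReal / (ρ (essProj ν S)).toReal) ^ 2) := by
          field_simp; ring
        rw [e]
        nlinarith [sq_nonneg (1 - ((ν.prod ρ) S).toReal / (ρ (essProj ν S)).toReal)]

end step

/-! ### Geometry of the convex distance and the induction -/

theorem add_mul_sq_le_of_sq_le_mul {M G s a d : ℝ} (hG : 0 ≤ G) (hs : 0 ≤ s)
    (h : M ^ 2 ≤ G * s) :
    (M + d * a) ^ 2 ≤ (d ^ 2 + G) * (a ^ 2 + s) := by
  have h1 : 2 * (M * (d * a)) ≤ d ^ 2 * s + G * a ^ 2 := by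
    apply le_of_sq_le_sq _ (by positivity)
    nlinarith [sq_nonneg (d ^ 2 * s - G * a ^ 2),
      mul_le_mul_of_nonneg_right h (sq_nonneg (d * a))]
  nlinarith

open Classical in
/-- Talagrand's squared convex distance of `x` from `S` is at most `c`, in homogeneous form. -/
def ConvexDistSqLE {N : ℕ} {E : Fin N → Type w} (S : Set (∀ j, E j)) (x : ∀ j, E j) (c : ℝ) :
    Prop :=
  ∀ α : Fin N → ℝ, (∀ j, 0 ≤ α j) →
    ∃ y ∈ S, (∑ j, if x j ≠ y j then α j else 0) ^ 2 ≤ c * ∑ j, α j ^ 2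

/-- For fixed α, the better of a witness from the section (cost A₁) and one from the projection
(cost at most A₂ + α₀) costs at most the t-average of the two, so no minimax argument is needed. The
section may be empty when t = 0. -/
theorem ConvexDistSqLE.convexComb {N : ℕ} {E : Fin (N + 1) → Type w} {S : Set (∀ j, E j)}
    {x : ∀ j, E j} {c₁ c₂ t : ℝ} (ht0 : 0 ≤ t) (ht1 : t ≤ 1) (hc₁ : 0 ≤ c₁) (hc₂ : 0 ≤ c₂)
    (h₁ : t ≠ 0 → ConvexDistSqLE {b | Fin.insertNth 0 (x 0) b ∈ S} (Fin.removeNth 0 x) c₁)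
    (h₂ : ConvexDistSqLE {b | ∃ a, Fin.insertNth 0 a b ∈ S} (Fin.removeNth 0 x) c₂) :
    ConvexDistSqLE S x ((1 - t) ^ 2 + (t * c₁ + (1 - t) * c₂)) := by
  classical
  intro α hα
  have hs : (0 : ℝ) ≤ ∑ j, α ((0 : Fin (N + 1)).succAbove j) ^ 2 :=
    Finset.sum_nonneg fun _ _ => sq_nonneg _
  obtain ⟨y₂, ⟨a, hy₂⟩, hA₂⟩ := h₂ (fun j => α ((0 : Fin (N + 1)).succAbove j)) (fun j => hα _)
  set A₂ := ∑ j, if Fin.removeNth 0 x j ≠ y₂ j then α ((0 : Fin (N + 1)).succAbove j) else 0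
    with hA₂def
  have hA₂0 : 0 ≤ A₂ := Finset.sum_nonneg fun j _ => by split_ifs <;> simp [hα]
  rw [Fin.sum_univ_succAbove (fun j => α j ^ 2) 0]
  have hz₂ : (∑ j, if x j ≠ Fin.insertNth (α := E) 0 a y₂ j then α j else 0) ≤ A₂ + α 0 := by
    rw [Fin.sum_univ_succAbove _ 0, add_comm]
    simp only [Fin.insertNth_apply_succAbove, Fin.insertNth_apply_same]
    refine add_le_add le_rfl ?_
    split_ifs <;> simp [hα]
  have hnn : ∀ y : ∀ j, E j, 0 ≤ ∑ j, if x j ≠ y j then α j else 0 := fun y =>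
    Finset.sum_nonneg fun j _ => by split_ifs <;> simp [hα]
  by_cases ht : t = 0
  · subst ht
    refine ⟨_, hy₂, (pow_le_pow_left₀ (hnn _) hz₂ 2).trans ?_⟩
    have := add_mul_sq_le_of_sq_le_mul (a := α 0) (d := 1) hc₂ hs hA₂
    simpa using this
  obtain ⟨y₁, hy₁, hA₁⟩ := h₁ ht (fun j => α ((0 : Fin (N + 1)).succAbove j)) (fun j => hα _)
  set A₁ := ∑ j, if Fin.removeNth 0 x j ≠ y₁ j then α ((0 : Fin (N + 1)).succAbove j) else 0
    with hA₁def
  have hA₁0 : 0 ≤ A₁ := Finset.sum_nonneg fun j _ => by split_ifs <;> simp [hα]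
  have hz₁ : (∑ j, if x j ≠ Fin.insertNth (α := E) 0 (x 0) y₁ j then α j else 0) ≤ A₁ := by
    rw [Fin.sum_univ_succAbove _ 0]
    simp only [Fin.insertNth_apply_succAbove, Fin.insertNth_apply_same]
    rw [if_neg (by simp), zero_add]
    exact le_rfl
  set s := ∑ j, α ((0 : Fin (N + 1)).succAbove j) ^ 2
  have hM : (t * A₁ + (1 - t) * A₂) ^ 2 ≤ (t * c₁ + (1 - t) * c₂) * s := by
    have h3 : 0 ≤ t * (1 - t) * (A₁ - A₂) ^ 2 := by
      have := sub_nonneg.2 ht1; positivity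
    have h4 := mul_le_mul_of_nonneg_left hA₁ ht0
    have h5 := mul_le_mul_of_nonneg_left hA₂ (sub_nonneg.2 ht1)
    nlinarith
  have h1t := sub_nonneg.2 ht1
  have key := add_mul_sq_le_of_sq_le_mul (a := α 0) (d := 1 - t) (by positivity) hs hM
  by_cases hle : A₁ ≤ A₂ + α 0
  · refine ⟨_, hy₁, (pow_le_pow_left₀ (hnn _) (hz₁.trans ?_) 2).trans key⟩
    nlinarith
  · refine ⟨_, hy₂, (pow_le_pow_left₀ (hnn _) (hz₂.trans ?_) 2).trans key⟩
    nlinarith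

theorem ConvexDistSqLE.mono {N : ℕ} {E : Fin N → Type w} {S T : Set (∀ j, E j)} {x : ∀ j, E j}
    {c : ℝ} (h : ConvexDistSqLE S x c) (hST : S ⊆ T) : ConvexDistSqLE T x c := fun α hα =>
  let ⟨y, hy, hc⟩ := h α hα
  ⟨y, hST hy, hc⟩

/-- Talagrand's convex distance inequality for product measures, uniformly measurable in a
parameter `θ` and with a measurable majorant in place of the convex distance itself. -/
theorem exists_measurable_convexDistSqLE (N : ℕ) : ∀ (Θ : Type w) [MeasurableSpace Θ]
    (E : Fin N → Type w) [∀ j, MeasurableSpace (E j)] (ν : ∀ j, Measure (E j))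
    [∀ j, IsProbabilityMeasure (ν j)] (S : Set (Θ × ∀ j, E j)), MeasurableSet S →
    ∃ g : Θ × (∀ j, E j) → ℝ, Measurable g ∧ (∀ z, 0 ≤ g z) ∧
      (∀ θ, Measure.pi ν {x | (θ, x) ∈ S} ≠ 0 → ∀ x, ConvexDistSqLE {x | (θ, x) ∈ S} x (g (θ, x))) ∧
      ∀ θ, ∫⁻ x, ENNReal.ofReal (Real.exp (g (θ, x) / 4)) ∂(Measure.pi ν) ≤
        (Measure.pi ν {x | (θ, x) ∈ S})⁻¹ := by
  induction N with
  | zero =>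
    intro Θ _ E _ ν _ S hS
    refine ⟨fun _ => 0, measurable_const, fun _ => le_rfl, fun θ hθ x α hα => ?_, fun θ => ?_⟩
    · obtain ⟨y, hy⟩ := nonempty_of_measure_ne_zero hθ
      exact ⟨y, hy, by simp⟩
    · simp [prob_le_one]
  | succ N ih =>
    intro Θ _ E _ ν _ S hS
    let A := E 0
    let B := ∀ j, E ((0 : Fin (N + 1)).succAbove j)
    let ρ : Measure B := Measure.pi fun j => ν ((0 : Fin (N + 1)).succAbove j)
    let e := MeasurableEquiv.piFinSuccAbove E 0
    have hmp : MeasurePreserving e (Measure.pi ν) ((ν 0).prod ρ) :=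
      measurePreserving_piFinSuccAbove ν 0
    let S₁ : Set ((Θ × A) × B) := {z | (z.1.1, e.symm (z.1.2, z.2)) ∈ S}
    have hS₁ : MeasurableSet S₁ := by
      refine Measurable.prodMk (by fun_prop) (e.symm.measurable.comp (by fun_prop)) hS
    let S₃ : Set ((Θ × B) × A) := {z | (z.1.1, e.symm (z.2, z.1.2)) ∈ S}
    have hS₃ : MeasurableSet S₃ := by
      refine Measurable.prodMk (by fun_prop) (e.symm.measurable.comp (by fun_prop)) hS
    let S₂ : Set (Θ × B) := {z | ν 0 (Prod.mk z ⁻¹' S₃) ≠ 0}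
    have hS₂ : MeasurableSet S₂ :=
      (measurable_measure_prodMk_left hS₃) (measurableSet_singleton 0).compl
    let R : Θ → Set (A × B) := fun θ => {z | (θ, e.symm z) ∈ S}
    have hR : ∀ θ, MeasurableSet (R θ) := fun θ =>
      Measurable.prodMk measurable_const e.symm.measurable hS
    have hRS : ∀ θ, Measure.pi ν {x | (θ, x) ∈ S} = ((ν 0).prod ρ) (R θ) := by
      intro θ
      rw [← hmp.measure_preimage (hR θ).nullMeasurableSet]
      congr 1; ext x
      change (θ, x) ∈ S ↔ (θ, e.symm (e x)) ∈ S
      rw [e.symm_apply_apply]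
    -- Absorbing x_0 into the parameter makes the sections' majorants jointly measurable.
    obtain ⟨f, hfm, hf0, hfS, hfi⟩ := ih (Θ × A) _
      (fun j => ν ((0 : Fin (N + 1)).succAbove j)) S₁ hS₁
    obtain ⟨g, hgm, hg0, hgS, hgi⟩ := ih Θ _
      (fun j => ν ((0 : Fin (N + 1)).succAbove j)) S₂ hS₂
    let F : Θ × (A × B) → ℝ := fun z =>
      stepEnvelope (ν 0) ρ (R z.1) (fun y => f ((z.1, y.1), y.2)) (fun b => g (z.1, b)) z.2
    have hFm : Measurable F := by
      have m1 : Measurable fun z : Θ × (A × B) => ρ {b | (z.2.1, b) ∈ R z.1} :=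
        (measurable_measure_prodMk_left (ν := ρ) hS₁).comp
          (g := fun z : Θ × A => ρ (Prod.mk z ⁻¹' S₁)) (f := fun z : Θ × (A × B) => (z.1, z.2.1))
          (by fun_prop)
      have m2 : Measurable fun z : Θ × (A × B) => ρ (essProj (ν 0) (R z.1)) :=
        (measurable_measure_prodMk_left (ν := ρ) hS₂).comp
          (g := fun z : Θ => ρ (Prod.mk z ⁻¹' S₂)) (f := fun z : Θ × (A × B) => z.1)
          (by fun_prop)
      have m3 := measurable_talagrandWeight.comp (m1.ennreal_toReal.div m2.ennreal_toReal)
      have m4 : Measurable fun z : Θ × (A × B) => f ((z.1, z.2.1), z.2.2) :=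
        hfm.comp (by fun_prop)
      have m5 : Measurable fun z : Θ × (A × B) => g (z.1, z.2.2) := hgm.comp (by fun_prop)
      exact ((m3.const_sub 1).pow_const 2).add ((m3.mul m4).add ((m3.const_sub 1).mul m5))
    refine ⟨fun z => F (z.1, e z.2), ?_, ?_, ?_, ?_⟩
    · exact hFm.comp (measurable_fst.prodMk (e.measurable.comp measurable_snd))
    · intro z
      refine add_nonneg (sq_nonneg _) (add_nonneg (mul_nonneg (talagrandWeight_nonneg _) (hf0 _))
        (mul_nonneg (sub_nonneg.2 (talagrandWeight_le_one _)) (hg0 _)))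
    · intro θ hθ x
      rw [hRS] at hθ
      refine ConvexDistSqLE.convexComb (talagrandWeight_nonneg _) (talagrandWeight_le_one _)
        (hf0 _) (hg0 _) (fun hw => ?_) ?_
      -- A nonzero weight forces a section of positive measure.
      · refine hfS (θ, x 0) (fun h0 => ?_) _
        have h0' : ρ {b | ((e x).1, b) ∈ R θ} = 0 := h0
        have := pos_of_talagrandWeight_ne_zero hw
        simp only [h0', ENNReal.toReal_zero, zero_div, lt_self_iff_false] at this
      · refine (hgS θ (measure_essProj_ne_zero (hR θ) hθ) _).mono fun b hb => ?_
        exact nonempty_of_measure_ne_zero (show ν 0 (Prod.mk (θ, b) ⁻¹' S₃) ≠ 0 from hb)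
    · intro θ
      rw [hRS]
      have hFθ : Measurable fun z => ENNReal.ofReal (Real.exp (F (θ, z) / 4)) :=
        (Real.measurable_exp.comp
          ((hFm.comp measurable_prodMk_left).div_const 4)).ennreal_ofReal
      have hfθ : Measurable fun y : A × B => f ((θ, y.1), y.2) := hfm.comp (by fun_prop)
      have hgθ : Measurable fun b => g (θ, b) := hgm.comp (by fun_prop)
      have key : ∫⁻ z, ENNReal.ofReal (Real.exp (F (θ, z) / 4)) ∂((ν 0).prod ρ) ≤
          (((ν 0).prod ρ) (R θ))⁻¹ :=
        lintegral_exp_stepEnvelope_le (hR θ) (f := fun y => f ((θ, y.1), y.2))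
          (g := fun b => g (θ, b)) hfθ hgθ (fun a => hfi (θ, a)) (hgi θ)
      clear_value F
      rwa [← hmp.lintegral_comp hFθ] at key

/-! ### Transfer to hypergraph-dependent vectors -/

open Classical in
theorem sum_ite_ne_le_sum_of_dependsOn {n N : ℕ} {Λ : Fin n → Type u} {E : Fin N → Type w}
    (T : Fin n → Finset (Fin N)) {f : (∀ j, E j) → ∀ i, Λ i}
    (hf : ∀ i y y', (∀ j ∈ T i, y j = y' j) → f y i = f y' i)
    {α : Fin n → ℝ} (hα : ∀ i, 0 ≤ α i) (y y' : ∀ j, E j) :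
    (∑ i, if f y i ≠ f y' i then α i else 0) ≤
      ∑ j, if y j ≠ y' j then (∑ i, if j ∈ T i then α i else 0) else 0 := by
  have h1 : ∀ j, (if y j ≠ y' j then (∑ i, if j ∈ T i then α i else 0) else 0) =
      ∑ i, if y j ≠ y' j then (if j ∈ T i then α i else 0) else 0 := by
    intro j; split_ifs <;> simp
  have hnn : ∀ i j, 0 ≤ if y j ≠ y' j then (if j ∈ T i then α i else 0) else 0 := by
    intro i j; split_ifs <;> simp [hα]
  simp_rw [h1]
  rw [Finset.sum_comm]
  refine Finset.sum_le_sum fun i _ => ?_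
  split_ifs with h
  · obtain ⟨j, hj, hne⟩ : ∃ j ∈ T i, y j ≠ y' j := by
      by_contra! hc
      exact h (hf i y y' hc)
    refine le_trans (le_of_eq ?_) (Finset.single_le_sum (fun j _ => hnn i j) (Finset.mem_univ j))
    rw [if_pos hne, if_pos hj]
  · exact Finset.sum_nonneg fun j _ => hnn i j

/-- Cauchy–Schwarz over the at most k indices incident to each j, then double counting: each i is
counted at most l times. -/
theorem sum_sq_sum_incident_le {n N k l : ℕ} (T : Fin n → Finset (Fin N))
    (hl : ∀ i, (T i).card ≤ l) (hk : ∀ j, (Finset.univ.filter (fun i => j ∈ T i)).card ≤ k)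
    (α : Fin n → ℝ) :
    ∑ j, (∑ i, if j ∈ T i then α i else 0) ^ 2 ≤ k * l * ∑ i, α i ^ 2 := by
  calc _ ≤ ∑ j, (k : ℝ) * ∑ i, (if j ∈ T i then α i ^ 2 else 0) := by
        refine Finset.sum_le_sum fun j _ => ?_
        rw [← Finset.sum_filter, ← Finset.sum_filter]
        refine sq_sum_le_card_mul_sum_sq.trans ?_
        gcongr
        exact hk j
    _ = ∑ i, (k : ℝ) * ((T i).card * α i ^ 2) := by
        rw [← Finset.mul_sum, Finset.sum_comm, ← Finset.mul_sum]
        congr 1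
        refine Finset.sum_congr rfl fun i _ => ?_
        rw [← Finset.sum_filter]
        simp
    _ ≤ ∑ i, (k : ℝ) * (l * α i ^ 2) := by
        gcongr with i
        exact hl i
    _ = _ := by simp_rw [← Finset.mul_sum]; ring

theorem convexDist_nonneg {n : ℕ} {Λ : Fin n → Type u} (x : ∀ i, Λ i) (S : Set (∀ i, Λ i)) :
    0 ≤ convexDist x S :=
  Real.iSup_nonneg fun α => Real.iInf_nonneg fun y => Finset.sum_nonneg fun i _ => by
    split_ifs <;> simp [α.2.1]

theorem convexDist_sq_le_of_dependsOn {n N k l : ℕ} {Λ : Fin n → Type u} {E : Fin N → Type w}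
    (T : Fin n → Finset (Fin N))
    (hl : ∀ i, (T i).card ≤ l) (hk : ∀ j, (Finset.univ.filter (fun i => j ∈ T i)).card ≤ k)
    {f : (∀ j, E j) → ∀ i, Λ i}
    (hf : ∀ i y y', (∀ j ∈ T i, y j = y' j) → f y i = f y' i)
    {S : Set (∀ i, Λ i)} {y : ∀ j, E j} {c : ℝ} (hc : 0 ≤ c) (h : ConvexDistSqLE (f ⁻¹' S) y c) :
    convexDist (f y) S ^ 2 ≤ k * l * c := by
  classical
  have hb : 0 ≤ (k : ℝ) * l * c := by positivity
  refine (Real.le_sqrt (convexDist_nonneg _ _) hb).1 ?_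
  -- The nonnegative bound also covers n = 0, where no unit vector exists and the supremum is 0 by
  -- convention.
  refine Real.iSup_le (fun α => ?_) (Real.sqrt_nonneg _)
  obtain ⟨y', hy', h1⟩ := h (fun j => ∑ i, if j ∈ T i then α.1 i else 0)
    (fun j => Finset.sum_nonneg fun i _ => by split_ifs <;> simp [α.2.1])
  refine (ciInf_le ⟨0, ?_⟩ (⟨f y', hy'⟩ : S)).trans ?_
  · rintro _ ⟨z, rfl⟩
    exact Finset.sum_nonneg fun i _ => by split_ifs <;> simp [α.2.1]
  · refine (sum_ite_ne_le_sum_of_dependsOn T hf α.2.1 y y').trans (Real.le_sqrt_of_sq_le ?_)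
    refine h1.trans ?_
    have h2 := sum_sq_sum_incident_le T hl hk α.1
    rw [α.2.2, mul_one] at h2
    rw [mul_comm _ c]
    gcongr

/-! ### Exponential moment and tail bound -/

theorem HDDependent.measurable {Ω : Type v} [MeasurableSpace Ω] {μ : Measure Ω}
    {n : ℕ} {Λ : Fin n → Type u} [∀ i, MeasurableSpace (Λ i)]
    {X : Ω → (i : Fin n) → Λ i} {k l : ℕ} (hX : HDDependent.{u, v, w} X μ l k) :
    Measurable X := by
  obtain ⟨N, E, _, Y, T, hY, -, hf, -, -⟩ := hX
  refine measurable_pi_iff.2 fun i => ?_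
  obtain ⟨f, hfm, hfX⟩ := hf i
  simp_rw [hfX]
  exact hfm.comp (measurable_pi_iff.2 fun j => hY j)

theorem HDDependent.lintegral_exp_convexDist_le {Ω : Type v} [MeasurableSpace Ω] {μ : Measure Ω}
    [IsProbabilityMeasure μ]
    {n : ℕ} {Λ : Fin n → Type u} [∀ i, MeasurableSpace (Λ i)]
    {X : Ω → (i : Fin n) → Λ i} {k l : ℕ} (hk : 0 < k) (hl : 0 < l)
    (hX : HDDependent.{u, v, w} X μ l k)
    {S : Set ((i : Fin n) → Λ i)} (hS : MeasurableSet S) (hpos : μ {ω | X ω ∈ S} ≠ 0) :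
    ∫⁻ ω, ENNReal.ofReal (Real.exp (convexDist (X ω) S ^ 2 / (4 * k * l))) ∂μ ≤
      (μ {ω | X ω ∈ S})⁻¹ := by
  obtain ⟨N, E, _, Y, T, hY, hind, hf, hcl, hck⟩ := hX
  choose f hfm hfX using hf
  let F : (∀ j, E j) → ∀ i, Λ i := fun y i => f i fun j => y j
  have hF : Measurable F := measurable_pi_iff.2 fun i =>
    (hfm i).comp (measurable_pi_iff.2 fun j => measurable_pi_apply _)
  have hFX : ∀ ω, X ω = F fun j => Y j ω := fun ω => funext fun i => hfX i ω
  have hYm : Measurable fun ω j => Y j ω := measurable_pi_iff.2 hY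
  have : ∀ j, IsProbabilityMeasure (μ.map (Y j)) := fun j =>
    Measure.isProbabilityMeasure_map (hY j).aemeasurable
  have hmap := (iIndepFun_iff_map_fun_eq_pi_map fun j => (hY j).aemeasurable).1 hind
  obtain ⟨g, hgm, hg0, hgS, hgi⟩ := exists_measurable_convexDistSqLE N PUnit.{w + 1} E
    (fun j => μ.map (Y j)) {z | F z.2 ∈ S} (hF.comp measurable_snd hS)
  have hμS : Measure.pi (fun j => μ.map (Y j)) {y | F y ∈ S} = μ {ω | X ω ∈ S} := by
    rw [← hmap]
    simp_rw [hFX]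
    exact Measure.map_apply hYm (hF hS)
  have hgi := hgi PUnit.unit
  simp only [Set.mem_ofPred_eq, hμS] at hgi hgS
  refine le_trans ?_ hgi
  rw [← hmap, lintegral_map (by fun_prop) hYm]
  refine lintegral_mono fun ω => ENNReal.ofReal_le_ofReal (Real.exp_le_exp.2 ?_)
  have h := convexDist_sq_le_of_dependsOn T hcl hck (f := F)
    (fun i y y' h => congrArg (f i) (funext fun j => h j j.2)) (hg0 _)
    (hgS PUnit.unit hpos fun j => Y j ω)
  rw [← hFX] at h
  have hk' : (0 : ℝ) < k := by exact_mod_cast hk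
  have hl' : (0 : ℝ) < l := by exact_mod_cast hl
  rw [div_le_div_iff₀ (by positivity) (by norm_num)]
  nlinarith

theorem mainTheorem2 {Ω : Type v} [MeasurableSpace Ω] (μ : Measure Ω) [IsProbabilityMeasure μ]
    {n : ℕ} {Λ : Fin n → Type u} [∀ i, MeasurableSpace (Λ i)]
    (X : Ω → (i : Fin n) → Λ i) (k l : ℕ) (hk : 0 < k) (hl : 0 < l)
    (hX : HDDependent.{u, v, w} X μ l k)
    (S : Set ((i : Fin n) → Λ i)) (hS : MeasurableSet S)
    (hd : AEMeasurable (fun x => convexDist x S) (μ.map X)) :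
    (0 < μ.real {ω | X ω ∈ S} →
      Integrable (fun ω => Real.exp (convexDist (X ω) S ^ 2 / (10 * k * l))) μ ∧
      ∫ ω, Real.exp (convexDist (X ω) S ^ 2 / (10 * k * l)) ∂μ ≤ 1 / μ.real {ω | X ω ∈ S}) ∧
    (∀ t : ℝ, 0 ≤ t →
      μ.real {ω | X ω ∈ S} * μ.real {ω | X ω ∉ convexEnlargement S t}
        ≤ Real.exp (-(t ^ 2 / (10 * k * l)))) := by
  have hk' : (0 : ℝ) < k := by exact_mod_cast hk
  have hl' : (0 : ℝ) < l := by exact_mod_cast hl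
  have main : 0 < μ.real {ω | X ω ∈ S} →
      Integrable (fun ω => Real.exp (convexDist (X ω) S ^ 2 / (10 * k * l))) μ ∧
      ∫ ω, Real.exp (convexDist (X ω) S ^ 2 / (10 * k * l)) ∂μ ≤ 1 / μ.real {ω | X ω ∈ S} := by
    intro hpos
    have hpos' : μ {ω | X ω ∈ S} ≠ 0 := fun h => by simp [Measure.real, h] at hpos
    have hlint : ∫⁻ ω, ENNReal.ofReal (Real.exp (convexDist (X ω) S ^ 2 / (10 * k * l))) ∂μ ≤
        (μ {ω | X ω ∈ S})⁻¹ := by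
      refine le_trans (lintegral_mono fun ω => ENNReal.ofReal_le_ofReal (Real.exp_le_exp.2 ?_))
        (hX.lintegral_exp_convexDist_le hk hl hS hpos')
      -- The constant 4 is relaxed to 10.
      gcongr
      norm_num
    have hmeas : AEStronglyMeasurable
        (fun ω => Real.exp (convexDist (X ω) S ^ 2 / (10 * k * l))) μ :=
      (Real.measurable_exp.comp_aemeasurable
        (((hd.comp_measurable hX.measurable).pow_const 2).div_const _)).aestronglyMeasurable
    have hnn : 0 ≤ᵐ[μ] fun ω => Real.exp (convexDist (X ω) S ^ 2 / (10 * k * l)) :=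
      ae_of_all _ fun ω => (Real.exp_pos _).le
    refine ⟨⟨hmeas, (hasFiniteIntegral_iff_ofReal hnn).2
      (hlint.trans_lt (ENNReal.inv_ne_top.2 hpos').lt_top)⟩, ?_⟩
    rw [integral_eq_lintegral_of_nonneg_ae hnn hmeas, one_div, Measure.real, ← ENNReal.toReal_inv]
    exact ENNReal.toReal_mono (ENNReal.inv_ne_top.2 hpos') hlint
  refine ⟨main, fun t ht => ?_⟩
  rcases (measureReal_nonneg (μ := μ) (s := {ω | X ω ∈ S})).eq_or_lt with h0 | hpos
  · rw [← h0, zero_mul]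
    exact (Real.exp_pos _).le
  obtain ⟨hint, hle⟩ := main hpos
  have hmarkov := mul_meas_ge_le_integral_of_nonneg (ae_of_all _ fun ω => (Real.exp_pos _).le) hint
    (Real.exp (t ^ 2 / (10 * k * l)))
  have hsub : μ.real {ω | X ω ∉ convexEnlargement S t} ≤
      μ.real {ω | Real.exp (t ^ 2 / (10 * k * l)) ≤
        Real.exp (convexDist (X ω) S ^ 2 / (10 * k * l))} := by
    refine measureReal_mono fun ω hω => Real.exp_le_exp.2 ?_
    have : t < convexDist (X ω) S := not_le.1 hω
    gcongr
  rw [Real.exp_neg, ← one_div, le_div_iff₀ (Real.exp_pos _)]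
  have h1 : Real.exp (t ^ 2 / (10 * k * l)) * μ.real {ω | X ω ∉ convexEnlargement S t} ≤
      1 / μ.real {ω | X ω ∈ S} :=
    (mul_le_mul_of_nonneg_left hsub (Real.exp_pos _).le).trans (hmarkov.trans hle)
  rw [le_div_iff₀ hpos] at h1
  linarith
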